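/- Let $R$ be a discrete valuation domain with maximal ideal $M$, finite residue field, quotient field $K$ and normalized valuation $v$, and let $\mathrm{Int}(R)=\{F\in K[x] : F(R)\subseteq R\}$ be the ring of integer-valued polynomials on $R$. An irreducible element $d$ of a domain is called *absolutely irreducible* if for every $n\ge 1$ the factorization of $d^n$ into irreducibles is unique up to order and units. The *fixed divisor* of $f\in R[x]$ is the ideal of $R$ generated by all values $f(a)$, $a\in R$. A finite set $S\subseteq R$ is *balanced* if, with $n_s$ (for $s\in S$) the minimal non-negative integer such that $s+M^{n_s}$ contains no element of $S$ other than $s$, the (disjoint) sets $s+M^{n_s}$, $s\in S$, cover $R$. For a finite non-empty set $S\subseteq R$, the *partition associated to* $S$ is the unique partition of $R$ of the form $\{s+M^{\rho_S(s)} : s\in S\}$, with non-negative integers $\rho_S(s)$, such that each block $s+M^{\rho_S(s)}$ contains both a residue class of $M^{\rho_S(s)+1}$ intersecting $S$ and a residue class of $M^{\rho_S(s)+1}$ disjoint from $S$. For balanced $S$, the *partition matrix* is $A=(a_{s,t})_{s,t\in S}$ with $a_{s,s}=\rho_S(s)$ and $a_{s,t}=v(s-t)$ for $s\neq t$, and the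 *equalizing polynomial* of $S$ is $\prod_{s\in S}(x-s)^{k_s}$, where $(k_s)_{s\in S}$ is the unique vector of positive integers with $\gcd(k_s : s\in S)=1$ such that $A(k_s)_{s\in S}=e\,(1,\dots,1)^{T}$ for some integer $e\ge 0$. **Theorem.** Let $f=\prod_{s\in S}(x-s)^{m_s}$ and $F=c^{-1}f$, where $S\subseteq R$ is a finite non-empty set, $m_s$ is a positive integer for each $s\in S$, and $c\in K\setminus\{0\}$. Then $F$ is (an element of $\mathrm{Int}(R)$ and) absolutely irreducible in $\mathrm{Int}(R)$ if and only if all of the following hold: 1. $S$ is balanced. 2. $f$ is the equalizing polynomial of $S$. 3. $c$ is a generator of the fixed divisor of $f$ (in particular $c\in R$). -/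

import Mathlib

open Polynomial IsLocalRing

namespace IntegerValued

/-- The ring `Int(R) = {F ∈ K[X] | F(R) ⊆ R}` of integer-valued polynomials on `R`,
as a subring of `K[X]`. -/
def intPoly (R K : Type*) [CommRing R] [Field K] [Algebra R K] : Subring K[X] where
  carrier := {F | ∀ a : R, F.eval (algebraMap R K a) ∈ (algebraMap R K).range}
  mul_mem' hF hG a := by
    rw [eval_mul]; exact mul_mem (hF a) (hG a)
  one_mem' a := by
    rw [eval_one]; exact one_mem _
  add_mem' hF hG a := by
    rw [eval_add]; exact add_mem (hF a) (hG a)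
  zero_mem' a := by
    rw [eval_zero]; exact zero_mem _
  neg_mem' hF a := by
    rw [eval_neg]; exact neg_mem (hF a)

/-- `a` factors uniquely: any two factorizations of `a` into irreducibles coincide up to the
order of the factors and up to units. -/
def FactorsUniquely {D : Type*} [CommRing D] (a : D) : Prop :=
  ∀ p q : Multiset D, (∀ b ∈ p, Irreducible b) → (∀ b ∈ q, Irreducible b) →
    p.prod = a → q.prod = a → Multiset.Rel Associated p q

/-- `d` is absolutely irreducible: it is irreducible and all its powers `d ^ n`, `n ≥ 1`,
factor uniquely. -/
def IsAbsolutelyIrreducible {D : Type*} [CommRing D] (d : D) : Prop :=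
  Irreducible d ∧ ∀ n : ℕ, 1 ≤ n → FactorsUniquely (d ^ n)

/-- The fixed divisor of `f ∈ R[X]`: the ideal of `R` generated by all the values `f(a)`,
`a ∈ R`. -/
def fixedDivisor {R : Type*} [CommRing R] (f : R[X]) : Ideal R :=
  Ideal.span (Set.range fun a : R => f.eval a)

/-- The residue class `r + M ^ n`, where `M` is the maximal ideal of `R`. -/
def nbhd {R : Type*} [CommRing R] [IsLocalRing R] (r : R) (n : ℕ) : Set R :=
  {x | x - r ∈ maximalIdeal R ^ n}

/-- A finite set `S` is balanced if, with `n s` the minimal number such that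
`s + M ^ (n s)` contains no other element of `S`, the sets `s + M ^ (n s)`, `s ∈ S`, cover `R`
(these sets are automatically disjoint when `R` is a discrete valuation ring). -/
def IsBalanced {R : Type*} [CommRing R] [IsLocalRing R] (S : Finset R) : Prop :=
  ∃ n : S → ℕ, (∀ s : S, IsLeast {k : ℕ | ∀ t ∈ S, t ∈ nbhd (s : R) k → t = s} (n s)) ∧
    ⋃ s : S, nbhd (s : R) (n s) = Set.univ

/-- The family `s + M ^ (ρ s)`, `s ∈ S`, is the partition of `R` associated to `S`: it is a
partition of `R` (possibly with `s + M ^ (ρ s) = t + M ^ (ρ t)` for some `s ≠ t`), and every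
block `s + M ^ (ρ s)` contains a residue class of `M ^ (ρ s + 1)` intersecting `S` and a
residue class of `M ^ (ρ s + 1)` disjoint from `S`. -/
structure IsAssociatedPartition {R : Type*} [CommRing R] [IsLocalRing R] (S : Finset R)
    (ρ : S → ℕ) : Prop where
  isPartition : Setoid.IsPartition (Set.range fun s : S => nbhd (s : R) (ρ s))
  exists_rich : ∀ s : S, ∃ r ∈ nbhd (s : R) (ρ s), (nbhd r (ρ s + 1) ∩ (S : Set R)).Nonempty
  exists_poor : ∀ s : S, ∃ r ∈ nbhd (s : R) (ρ s), Disjoint (nbhd r (ρ s + 1)) (S : Set R)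

open Classical in
/-- The partition matrix, with rows and columns indexed by `S`: `ρ s` on the diagonal and
the normalized valuation `v(s - t)` (finite, since `s ≠ t`) off the diagonal. -/
noncomputable def partitionMatrix {R : Type*} [CommRing R] [IsDomain R]
    [IsDiscreteValuationRing R] (S : Finset R) (ρ : S → ℕ) : Matrix S S ℕ :=
  Matrix.of fun s t =>
    if s = t then ρ s else (IsDiscreteValuationRing.addVal R ((s : R) - (t : R))).toNat

/-- For a balanced set `S`: `f` is the equalizing polynomial `∏ (X - s) ^ (m s)` of `S`, where
`m` is the positive integer vector with `gcd` one that solves `A m = e (1, …, 1)` for some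
`e ≥ 0`, with `A` the partition matrix of the partition associated to `S`. -/
def IsEqualizingPolynomial {R : Type*} [CommRing R] [IsDomain R]
    [IsDiscreteValuationRing R] (S : Finset R) (f : R[X]) : Prop :=
  ∃ (ρ : S → ℕ) (m : S → ℕ) (e : ℕ), IsAssociatedPartition S ρ ∧
    (∀ s, 0 < m s) ∧ Finset.univ.gcd m = 1 ∧
    Matrix.mulVec (partitionMatrix S ρ) m = (fun _ => e) ∧
    f = ∏ s : S, (X - C (s : R)) ^ m s

end IntegerValued

set_option linter.unusedSectionVars false

/-! A factor of a power of `F` splits in `K[X]` with roots in `S`, so it is a constant `y` times `∏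
(X - s) ^ l s`. On the block of `s` in the associated partition, `v(a - t)` is at least `B s t = min
(ρ s) (v(s - t))`, with equality for all `t` at once on a residue class avoiding `S`. Membership in
`Int(R)` is therefore the linear system `v(y) + (B l) s ≥ 0` (`C_mul_linProd_mem_intPoly_iff`), and
the theorem becomes a statement about the matrix `B`.

Sufficiency: for balanced `S`, `B` is the partition matrix; it is strictly ultrametric, hence
nonsingular, except when it is the zero matrix of a singleton. In a factorization of `F ^ n` the
inequalities for the two factors add up to equalities, so each is an equality. Nonsingularity and
`gcd = 1` then make each exponent vector a natural multiple of that of `F`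
(`exists_eq_of_mul_eq_pow`).

Necessity: let `e = v(c)` and call row `s` tight if `(B m) s = e`. If all tight rows annihilate `w`,
then for large `n` the vectors `n m + w` and `n m - w` give elements of `Int(R)` with product `F ^
(2 * n)`, so `w` is a multiple of `m`. For `e ≠ 0` it follows that `B` with its non-tight rows
erased is nonsingular: every row is tight and no two rows agree. Elements of a common block have
equal rows, so blocks contain one element each and `S` is balanced. The conditions on the gcd and
the fixed divisor then need only irreducibility of `F`. -/

namespace IntegerValued

/-! ### Residue classes, the associated partition and truncated valuations. -/

section Ultrametric

open IsDiscreteValuationRing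

variable {R : Type*} [CommRing R] [IsDomain R] [IsDiscreteValuationRing R]

theorem le_addVal_iff_pow_dvd {π : R} (hπ : Irreducible π) {n : ℕ} {x : R} :
    (n : ℕ∞) ≤ addVal R x ↔ π ^ n ∣ x := by
  rw [← hπ.addVal_pow n, addVal_le_iff_dvd]

theorem mem_nbhd {r x : R} {n : ℕ} : x ∈ nbhd r n ↔ (n : ℕ∞) ≤ addVal R (x - r) := by
  obtain ⟨π, hπ⟩ := exists_irreducible R
  rw [le_addVal_iff_pow_dvd hπ, nbhd, Set.mem_ofPred_eq, hπ.maximalIdeal_eq, Ideal.span_singleton_pow,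
    Ideal.mem_span_singleton]

theorem mem_nbhd_self (r : R) (n : ℕ) : r ∈ nbhd r n := by simp [nbhd]

theorem mem_nbhd_comm {r x : R} {n : ℕ} : x ∈ nbhd r n ↔ r ∈ nbhd x n := by
  rw [mem_nbhd, mem_nbhd, AddValuation.map_sub_swap]

theorem mem_nbhd_trans {r x y : R} {n : ℕ} (h : x ∈ nbhd r n) (h' : y ∈ nbhd x n) :
    y ∈ nbhd r n := by
  have := Ideal.add_mem _ h h'
  rwa [add_comm, sub_add_sub_cancel] at this

theorem nbhd_anti {r : R} {m n : ℕ} (h : m ≤ n) : nbhd r n ⊆ nbhd r m :=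
  fun _ hx => Ideal.pow_le_pow_right h hx

theorem nbhd_eq_of_mem {r x : R} {n : ℕ} (h : x ∈ nbhd r n) : nbhd x n = nbhd r n :=
  Set.Subset.antisymm (fun _ hy => mem_nbhd_trans h hy)
    fun _ hy => mem_nbhd_trans (mem_nbhd_comm.1 h) hy

theorem exists_not_mem_nbhd {r x : R} (h : x ≠ r) : ∃ n, x ∉ nbhd r n := by
  obtain ⟨k, hk⟩ := ENat.ne_top_iff_exists.1 (mt addVal_eq_top_iff.1 (sub_ne_zero.2 h))
  refine ⟨k + 1, fun hx => ?_⟩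
  rw [mem_nbhd, ← hk, Nat.cast_le] at hx
  omega

theorem exists_maximal_nbhd {r x : R} (h : x ≠ r) :
    ∃ n, x ∈ nbhd r n ∧ x ∉ nbhd r (n + 1) := by
  obtain ⟨k, hk⟩ := ENat.ne_top_iff_exists.1 (mt addVal_eq_top_iff.1 (sub_ne_zero.2 h))
  refine ⟨k, mem_nbhd.2 hk.le, fun hx => ?_⟩
  rw [mem_nbhd, ← hk, Nat.cast_le] at hx
  omega

/-- For every `s` there is a residue class inside a neighbourhood of `s` that avoids `S`. -/
theorem exists_disjoint_nbhd (S : Finset R) (s : S) :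
    ∃ n, ∃ r ∈ nbhd (s : R) n, Disjoint (nbhd r (n + 1)) (S : Set R) := by
  obtain ⟨π, hπ⟩ := exists_irreducible R
  have h : ∀ t : R, ∃ n, t ≠ s → t ∉ nbhd (s : R) n := fun t => by
    by_cases ht : t = s
    · exact ⟨0, fun h => (h ht).elim⟩
    · obtain ⟨n, hn⟩ := exists_not_mem_nbhd ht
      exact ⟨n, fun _ => hn⟩
  choose n hn using h
  -- At depth `S.sup n` the point `s` is already isolated in `S`, and the witness has distance
  -- exactly `S.sup n` from `s`, so its next smaller class misses `s` too.
  have hmem : (s : R) + π ^ (S.sup n) ∈ nbhd (s : R) (S.sup n) := by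
    rw [mem_nbhd, add_sub_cancel_left, hπ.addVal_pow]
  refine ⟨S.sup n, s + π ^ (S.sup n), hmem, Set.disjoint_left.2 fun t ht htS => ?_⟩
  by_cases hts : t = s
  · rw [hts, mem_nbhd, sub_add_cancel_left, AddValuation.map_neg, hπ.addVal_pow, Nat.cast_le] at ht
    omega
  · exact hn t hts (nbhd_anti (Finset.le_sup (f := n) htS)
      (mem_nbhd_trans hmem (nbhd_anti (Nat.le_succ _) ht)))

/-- Take `ρ s` to be the least depth at which the class of `s` has a subclass one level down that
avoids `S`. Minimality makes `ρ` constant on each block, so blocks that meet coincide. -/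
theorem exists_isAssociatedPartition (S : Finset R) (hS : S.Nonempty) :
    ∃ ρ : S → ℕ, IsAssociatedPartition S ρ ∧
      ∀ s t : S, (t : R) ∈ nbhd (s : R) (ρ s) → ρ t = ρ s := by
  classical
  let ρ : S → ℕ := fun s => Nat.find (exists_disjoint_nbhd S s)
  have hρ : ∀ s : S, ∃ r ∈ nbhd (s : R) (ρ s), Disjoint (nbhd r (ρ s + 1)) (S : Set R) :=
    fun s => Nat.find_spec (exists_disjoint_nbhd S s)
  have hmin : ∀ (s : S) (n : ℕ) (r : R), r ∈ nbhd (s : R) n →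
      Disjoint (nbhd r (n + 1)) (S : Set R) → ρ s ≤ n := fun s n r h h' =>
    Nat.find_min' (exists_disjoint_nbhd S s) ⟨r, h, h'⟩
  have hle : ∀ s t : S, (t : R) ∈ nbhd (s : R) (ρ s) → ρ t ≤ ρ s := fun s t h => by
    obtain ⟨r, hr, hr'⟩ := hρ s
    exact hmin t _ r (mem_nbhd_trans (mem_nbhd_comm.1 h) hr) hr'
  have heq : ∀ s t : S, (t : R) ∈ nbhd (s : R) (ρ s) → ρ t = ρ s := fun s t h =>
    le_antisymm (hle s t h) (hle t s (nbhd_anti (hle s t h) (mem_nbhd_comm.1 h)))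
  have heq' : ∀ (s t : S) (a : R), a ∈ nbhd (s : R) (ρ s) → a ∈ nbhd (t : R) (ρ t) →
      nbhd (s : R) (ρ s) = nbhd (t : R) (ρ t) := by
    intro s t a hs ht
    wlog h : ρ s ≤ ρ t generalizing s t
    · exact (this t s ht hs (le_of_not_ge h)).symm
    have hst : (t : R) ∈ nbhd (s : R) (ρ s) :=
      mem_nbhd_trans hs (mem_nbhd_comm.1 (nbhd_anti h ht))
    rw [heq s t hst, nbhd_eq_of_mem hst]
  refine ⟨ρ, ⟨⟨?_, fun a => ?_⟩, fun s => ⟨s, mem_nbhd_self _ _, s, mem_nbhd_self _ _, s.2⟩, hρ⟩,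
    heq⟩
  · rintro ⟨s, hs⟩
    exact (Set.mem_empty_iff_false (s : R)).1 (hs ▸ mem_nbhd_self (s : R) (ρ s))
  · have hcover : ∃ s : S, a ∈ nbhd (s : R) (ρ s) := by
      by_cases ha : a ∈ S
      · exact ⟨⟨a, ha⟩, mem_nbhd_self _ _⟩
      · choose n hn hn' using fun s : S => exists_maximal_nbhd (r := (s : R)) (x := a)
          fun h => ha (h ▸ s.2)
        have : Nonempty S := hS.to_subtype
        -- For `s` nearest to `a`, the class of `a` one level below their distance avoids `S`, so `ρ
        -- s` is at most that depth and `a` lies in the block of `s`.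
        obtain ⟨s, hs⟩ := Finite.exists_max n
        refine ⟨s, nbhd_anti (hmin s (n s) a (hn s) (Set.disjoint_left.2 fun t ht htS => ?_)) (hn s)⟩
        exact hn' ⟨t, htS⟩ (nbhd_anti (Nat.succ_le_succ (hs ⟨t, htS⟩)) (mem_nbhd_comm.1 ht))
    obtain ⟨s, hs⟩ := hcover
    refine ⟨_, ⟨⟨s, rfl⟩, hs⟩, ?_⟩
    rintro _ ⟨⟨t, rfl⟩, ht⟩
    exact heq' t s a ht hs

/-- The truncated valuations `min (ρ s) (v (s - t))`. -/
noncomputable def blockMatrix (S : Finset R) (ρ : S → ℕ) : Matrix S S ℤ :=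
  Matrix.of fun s t => ((min (ρ s : ℕ∞) (addVal R ((s : R) - (t : R)))).toNat : ℤ)

theorem exists_blockMatrix_eq (S : Finset R) (ρ : S → ℕ) (s t : S) :
    ∃ b : ℕ, blockMatrix S ρ s t = b ∧ (b : ℕ∞) = min (ρ s : ℕ∞) (addVal R ((s : R) - (t : R))) := by
  refine ⟨_, rfl, ENat.natCast_toNat (ne_top_of_le_ne_top (ENat.natCast_ne_top (ρ s)) (min_le_left _ _))⟩

theorem blockMatrix_nonneg (S : Finset R) (ρ : S → ℕ) (s t : S) : 0 ≤ blockMatrix S ρ s t :=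
  Int.natCast_nonneg _

theorem blockMatrix_self (S : Finset R) (ρ : S → ℕ) (s : S) : blockMatrix S ρ s s = ρ s := by
  simp [blockMatrix]

/-- Moving `s` by something of valuation at least `ρ s` does not affect valuations truncated at `ρ
s`. This is what later excludes blocks with two elements. -/
theorem blockMatrix_row_eq (S : Finset R) {ρ : S → ℕ} {s t : S}
    (h : (t : R) ∈ nbhd (s : R) (ρ s)) (hρ : ρ t = ρ s) : blockMatrix S ρ t = blockMatrix S ρ s := by
  funext u
  simp only [blockMatrix, Matrix.of_apply, hρ]
  congr 2
  rw [mem_nbhd] at h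
  have h' : (ρ s : ℕ∞) ≤ addVal R ((s : R) - t) := by rwa [AddValuation.map_sub_swap]
  apply le_antisymm
  · refine le_min (min_le_left _ _) ?_
    rw [← sub_add_sub_cancel (s : R) t u]
    exact (min_le_min_right _ h').trans addVal_add
  · refine le_min (min_le_left _ _) ?_
    rw [← sub_add_sub_cancel (t : R) s u]
    exact (min_le_min_right _ h).trans addVal_add

theorem mem_nbhd_blockMatrix (S : Finset R) {ρ : S → ℕ} {s : S} {a : R}
    (ha : a ∈ nbhd (s : R) (ρ s)) (t : S) :
    (((blockMatrix S ρ s t).toNat : ℕ) : ℕ∞) ≤ addVal R (a - t) := by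
  obtain ⟨b, hb, hb'⟩ := exists_blockMatrix_eq S ρ s t
  rw [hb, Int.toNat_natCast, hb', ← sub_add_sub_cancel a s t]
  exact (min_le_min_right _ (mem_nbhd.1 ha)).trans addVal_add

/-- No `t` is closer to `r` than `ρ s`, hence `v(r - t) ≤ ρ s ≤ v(s - r)`, and the ultrametric
inequality bounds `v(r - t)` by `v(s - t)` as well. One `r` thus attains the minimum for every `t`
simultaneously. -/
theorem addVal_sub_eq_blockMatrix (S : Finset R) {ρ : S → ℕ} {s : S} {r : R}
    (hr : r ∈ nbhd (s : R) (ρ s)) (hr' : Disjoint (nbhd r (ρ s + 1)) (S : Set R)) (t : S) :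
    addVal R (r - t) = (((blockMatrix S ρ s t).toNat : ℕ) : ℕ∞) := by
  refine le_antisymm ?_ (mem_nbhd_blockMatrix S hr t)
  obtain ⟨b, hb, hb'⟩ := exists_blockMatrix_eq S ρ s t
  rw [hb, Int.toNat_natCast, hb']
  have h1 : addVal R (r - t) ≤ ρ s := by
    by_contra! h
    refine Set.disjoint_left.1 hr' (mem_nbhd_comm.1 (mem_nbhd.2 ?_)) t.2
    push_cast
    exact Order.add_one_le_of_lt h
  refine le_min h1 ?_
  have h2 : addVal R (r - t) ≤ addVal R (s - r) := by
    rw [AddValuation.map_sub_swap _ (s : R)]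
    exact h1.trans (mem_nbhd.1 hr)
  rw [← sub_add_sub_cancel (s : R) r t]
  exact (le_min h2 le_rfl).trans addVal_add

theorem IsAssociatedPartition.exists_mem {S : Finset R} {ρ : S → ℕ}
    (h : IsAssociatedPartition S ρ) (a : R) : ∃ s : S, a ∈ nbhd (s : R) (ρ s) := by
  obtain ⟨_, ⟨⟨s, rfl⟩, hs⟩, -⟩ := h.isPartition.2 a
  exact ⟨s, hs⟩

/-- The blocks of the partition associated to a balanced set each contain one element of it. -/
theorem IsBalanced.eq_of_mem_nbhd {S : Finset R} (hS : IsBalanced S) {ρ : S → ℕ}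
    (hρ : IsAssociatedPartition S ρ) {s t : S} (h : (t : R) ∈ nbhd (s : R) (ρ s)) : t = s := by
  obtain ⟨n, hn, hcover⟩ := hS
  suffices n s ≤ ρ s from Subtype.ext ((hn s).1 t t.2 (nbhd_anti this h))
  obtain ⟨r, hr, hr'⟩ := hρ.exists_poor s
  obtain ⟨u, hu⟩ := Set.mem_iUnion.1 (hcover.ge (Set.mem_univ r))
  -- Otherwise `u` would lie in the class of `r` modulo `M ^ (ρ s + 1)`, which avoids `S`.
  have hle : n u ≤ ρ s := by
    by_contra! hlt
    exact Set.disjoint_left.1 hr' (mem_nbhd_comm.1 (nbhd_anti hlt hu)) u.2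
  have : (s : R) = u := (hn u).1 s s.2 (mem_nbhd_trans hu (mem_nbhd_comm.1 (nbhd_anti hle hr)))
  rwa [← Subtype.ext this] at hle

theorem isBalanced_of_isAssociatedPartition {S : Finset R} {ρ : S → ℕ}
    (hρ : IsAssociatedPartition S ρ)
    (h : ∀ s t : S, (t : R) ∈ nbhd (s : R) (ρ s) → t = s) : IsBalanced S := by
  classical
  have hex : ∀ s : S, ∃ k : ℕ, ∀ t ∈ S, t ∈ nbhd (s : R) k → t = s := fun s =>
    ⟨ρ s, fun t ht hts => congrArg Subtype.val (h s ⟨t, ht⟩ hts)⟩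
  refine ⟨fun s => Nat.find (hex s), fun s => ⟨Nat.find_spec (hex s), fun k hk =>
    Nat.find_min' (hex s) hk⟩, Set.eq_univ_of_forall fun a => ?_⟩
  obtain ⟨s, hs⟩ := hρ.exists_mem a
  exact Set.mem_iUnion.2 ⟨s, nbhd_anti (Nat.find_min' (hex s) fun t ht hts =>
    congrArg Subtype.val (h s ⟨t, ht⟩ hts)) hs⟩

theorem partitionMatrix_eq_blockMatrix {S : Finset R} {ρ : S → ℕ}
    (h : ∀ s t : S, (t : R) ∈ nbhd (s : R) (ρ s) → t = s) (s t : S) :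
    (partitionMatrix S ρ s t : ℤ) = blockMatrix S ρ s t := by
  by_cases hst : s = t
  · subst hst
    simp [partitionMatrix, blockMatrix_self]
  · have : addVal R ((s : R) - t) ≤ ρ s := by
      by_contra! hlt
      rw [AddValuation.map_sub_swap] at hlt
      exact hst (h s t (mem_nbhd.2 hlt.le)).symm
    simp [partitionMatrix, blockMatrix, hst, this]

end Ultrametric

/-! ### Nonsingularity of strictly ultrametric matrices. -/

section SumOfSquares

/-- The relation is a partial equivalence, so its indicator matrix is block diagonal with all-ones
blocks, and each class contributes the square of its sum. Classes are encoded as finsets; a finset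
that is not a class contributes zero. -/
theorem sum_sum_ite_mul_eq {ι : Type*} [Fintype ι] [DecidableEq ι] (r : ι → ι → Prop)
    [DecidableRel r] (hsymm : ∀ s t, r s t → r t s) (htrans : ∀ s t u, r s t → r t u → r s u)
    (w : ι → ℤ) :
    ∑ s, ∑ t, (if r s t then 1 else 0) * (w s * w t) =
      ∑ c : Finset ι, (∑ s, if r s s ∧ Finset.univ.filter (r s) = c then w s else 0) ^ 2 := by
  simp_rw [sq, Finset.sum_mul_sum]
  rw [Finset.sum_comm (s := Finset.univ (α := Finset ι))]
  refine Finset.sum_congr rfl fun s _ => ?_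
  rw [Finset.sum_comm]
  refine Finset.sum_congr rfl fun t _ => ?_
  rw [Finset.sum_eq_single_of_mem (Finset.univ.filter (r s)) (Finset.mem_univ _)]
  · by_cases hst : r s t
    · have h1 := htrans _ _ _ hst (hsymm _ _ hst)
      have h2 := htrans _ _ _ (hsymm _ _ hst) hst
      have h3 : Finset.univ.filter (r t) = Finset.univ.filter (r s) := by
        ext u
        simp only [Finset.mem_filter_univ]
        exact ⟨htrans _ _ _ hst, htrans _ _ _ (hsymm _ _ hst)⟩
      simp [hst, h1, h2, h3]
    · by_cases ht : r t t ∧ Finset.univ.filter (r t) = Finset.univ.filter (r s)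
      · refine (hst ?_).elim
        have : t ∈ Finset.univ.filter (r s) := ht.2 ▸ by simpa using ht.1
        simpa using this
      · simp [hst, ht]
  · rintro c - hc
    simp [hc.symm]

/-- Strictly ultrametric matrices are nonsingular. -/
theorem eq_zero_of_sum_ultrametric_mul_eq_zero {ι : Type*} [Fintype ι] (a : ι → ι → ℕ)
    (hsymm : ∀ s t, a s t = a t s) (hmin : ∀ s t u, min (a s t) (a t u) ≤ a s u)
    (hpos : ∀ s, 0 < a s s) (hlt : ∀ s t, t ≠ s → a s t < a s s) (w : ι → ℤ)
    (h : ∀ s, ∑ t, (a s t : ℤ) * w t = 0) : w = 0 := by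
  classical
  set N := ∑ s, ∑ t, a s t
  have hN : ∀ s t, a s t ≤ N := fun s t =>
    (Finset.single_le_sum (fun _ _ => Nat.zero_le _) (Finset.mem_univ t)).trans
      (Finset.single_le_sum (f := fun s => ∑ t, a s t) (fun _ _ => Nat.zero_le _)
        (Finset.mem_univ s))
  -- Layer-cake decomposition: each level set `n < a s t` is a partial equivalence by the
  -- ultrametric inequality, so the quadratic form of `a` is a sum of squares.
  have ha : ∀ s t, (a s t : ℤ) = ∑ n ∈ Finset.range N, if n < a s t then 1 else 0 := fun s t => by
    rw [Finset.sum_boole]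
    congr 1
    rw [show (Finset.range N).filter (fun n => n < a s t) = Finset.range (a s t) by
      ext n; simp only [Finset.mem_filter, Finset.mem_range]
      exact ⟨And.right, fun h => ⟨h.trans_le (hN s t), h⟩⟩, Finset.card_range]
  have hQ : ∑ n ∈ Finset.range N, ∑ c : Finset ι,
      (∑ s, if n < a s s ∧ Finset.univ.filter (fun t => n < a s t) = c then w s else 0) ^ 2 = 0 := by
    calc _ = ∑ n ∈ Finset.range N, ∑ s, ∑ t, (if n < a s t then 1 else 0) * (w s * w t) := by
          refine Finset.sum_congr rfl fun n _ => ?_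
          exact (sum_sum_ite_mul_eq (fun s t => n < a s t) (fun s t h => hsymm s t ▸ h)
            (fun s t u h h' => (lt_min h h').trans_le (hmin s t u)) w).symm
      _ = ∑ s, w s * ∑ t, (a s t : ℤ) * w t := by
          rw [Finset.sum_comm]
          refine Finset.sum_congr rfl fun s _ => ?_
          rw [Finset.sum_comm, Finset.mul_sum]
          refine Finset.sum_congr rfl fun t _ => ?_
          rw [← Finset.sum_mul, ← ha]
          ring
      _ = 0 := by simp [h]
  funext s
  -- At level `a s s - 1` the class of `s` is `{s}`, because the diagonal strictly dominates; the
  -- corresponding square is `w s ^ 2`.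
  have h1 := (Finset.sum_eq_zero_iff_of_nonneg fun n _ => Finset.sum_nonneg fun c _ =>
    sq_nonneg _).1 hQ (a s s - 1) (Finset.mem_range.2 (by have := hN s s; have := hpos s; omega))
  have h2 := (Finset.sum_eq_zero_iff_of_nonneg fun c _ => sq_nonneg _).1 h1
    (Finset.univ.filter fun t => a s s - 1 < a s t) (Finset.mem_univ _)
  rw [sq_eq_zero_iff, Finset.sum_eq_single_of_mem s (Finset.mem_univ _)] at h2
  · simpa [hpos s] using h2
  · intro t _ hts
    rw [if_neg]
    rintro ⟨h3, h4⟩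
    have : t ∈ Finset.univ.filter fun u => a s s - 1 < a s u := h4 ▸ by simpa using h3
    rw [Finset.mem_filter_univ] at this
    have := hlt s t hts
    omega

end SumOfSquares

/-! ### Integer orders of elements of the quotient field. -/

section Order

open IsDiscreteValuationRing

variable {R K : Type*} [CommRing R] [IsDomain R] [IsDiscreteValuationRing R] [Field K]
  [Algebra R K] [IsFractionRing R K] {π : R}

/-- `y` is the product of a unit of `R` and of `π ^ z`. -/
def HasOrder (π : R) (y : K) (z : ℤ) : Prop :=
  ∃ u : Rˣ, y = algebraMap R K u * algebraMap R K π ^ z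

theorem algebraMap_ne_zero_of_irreducible (hπ : Irreducible π) : algebraMap R K π ≠ 0 := by
  simpa using hπ.ne_zero

theorem exists_hasOrder (hπ : Irreducible π) {y : K} (hy : y ≠ 0) : ∃ z, HasOrder π y z := by
  obtain ⟨z, u, h⟩ := exists_units_eq_smul_zpow_of_irreducible hπ hy
  exact ⟨z, u, by rw [h, Units.smul_def, Algebra.smul_def]⟩

theorem hasOrder_zpow (z : ℤ) : HasOrder π (algebraMap R K π ^ z) z := ⟨1, by simp⟩

theorem hasOrder_algebraMap (hπ : Irreducible π) {r : R} {n : ℕ} (h : addVal R r = n) :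
    HasOrder π (algebraMap R K r) n := by
  have hr : r ≠ 0 := by
    rintro rfl
    simp at h
  obtain ⟨k, u, rfl⟩ := eq_unit_mul_pow_irreducible hr hπ
  rw [addVal_def' u hπ, Nat.cast_inj] at h
  exact ⟨u, by simp [h]⟩

theorem HasOrder.mul (hπ : Irreducible π) {x y : K} {m n : ℤ} (hx : HasOrder π x m)
    (hy : HasOrder π y n) : HasOrder π (x * y) (m + n) := by
  obtain ⟨u, rfl⟩ := hx
  obtain ⟨v, rfl⟩ := hy
  refine ⟨u * v, ?_⟩
  rw [zpow_add₀ (algebraMap_ne_zero_of_irreducible hπ), Units.val_mul, map_mul]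
  ring

theorem HasOrder.inv {x : K} {m : ℤ} (hx : HasOrder π x m) : HasOrder π x⁻¹ (-m) := by
  obtain ⟨u, rfl⟩ := hx
  refine ⟨u⁻¹, ?_⟩
  rw [mul_inv, zpow_neg, map_units_inv]

theorem HasOrder.pow (hπ : Irreducible π) {x : K} {m : ℤ} (hx : HasOrder π x m) (n : ℕ) :
    HasOrder π (x ^ n) (n * m) := by
  induction n with
  | zero => simpa using hasOrder_zpow (K := K) (π := π) 0
  | succ n ih => rw [pow_succ, Nat.cast_succ, add_mul, one_mul]; exact ih.mul hπ hx

theorem HasOrder.prod (hπ : Irreducible π) {ι : Type*} (s : Finset ι) {f : ι → K} {g : ι → ℤ}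
    (h : ∀ i ∈ s, HasOrder π (f i) (g i)) : HasOrder π (∏ i ∈ s, f i) (∑ i ∈ s, g i) := by
  classical
  induction s using Finset.induction_on with
  | empty => simpa using hasOrder_zpow (K := K) (π := π) 0
  | insert a s ha ih =>
    rw [Finset.prod_insert ha, Finset.sum_insert ha]
    exact (h a (Finset.mem_insert_self _ _)).mul hπ (ih fun i hi => h i (Finset.mem_insert_of_mem hi))

theorem HasOrder.ne_zero (hπ : Irreducible π) {x : K} {m : ℤ} (hx : HasOrder π x m) : x ≠ 0 := by
  obtain ⟨u, rfl⟩ := hx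
  exact mul_ne_zero (by simp) (zpow_ne_zero _ (algebraMap_ne_zero_of_irreducible hπ))

theorem HasOrder.mem_range_iff (hπ : Irreducible π) {x : K} {m : ℤ} (hx : HasOrder π x m) :
    x ∈ (algebraMap R K).range ↔ 0 ≤ m := by
  obtain ⟨u, rfl⟩ := hx
  constructor
  · rintro ⟨r, hr⟩
    by_contra! hm
    obtain ⟨n, rfl⟩ : ∃ n : ℕ, m = -(n + 1 : ℕ) := ⟨(-m - 1).toNat, by omega⟩
    rw [zpow_neg, zpow_natCast, ← map_pow, eq_mul_inv_iff_mul_eq₀ (by simpa using hπ.ne_zero),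
      ← map_mul] at hr
    have hr' := IsFractionRing.injective R K hr
    exact hπ.not_isUnit (isUnit_of_dvd_unit ⟨r * π ^ n, by rw [← hr']; ring⟩ u.isUnit)
  · intro hm
    lift m to ℕ using hm
    exact ⟨u * π ^ m, by simp⟩

theorem HasOrder.unique (hπ : Irreducible π) {x : K} {m n : ℤ} (hm : HasOrder π x m)
    (hn : HasOrder π x n) : m = n := by
  have h1 := (hm.mul hπ hn.inv).mem_range_iff hπ
  have h2 := (hn.mul hπ hm.inv).mem_range_iff hπ
  rw [mul_inv_cancel₀ (hm.ne_zero hπ)] at h1 h2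
  have h3 := h1.1 (one_mem _)
  have h4 := h2.1 (one_mem _)
  omega

theorem HasOrder.exists_unit {x : K} (hx : HasOrder π x 0) : ∃ u : Rˣ, x = algebraMap R K u := by
  obtain ⟨u, hu⟩ := hx
  exact ⟨u, by simpa using hu⟩

end Order

theorem associated_pow_card_prod {D : Type*} [CommMonoid D] {F : D} {p : Multiset D}
    (h : ∀ b ∈ p, Associated F b) : Associated (F ^ p.card) p.prod := by
  induction p using Multiset.induction_on with
  | empty => simp
  | cons a p ih =>
    rw [Multiset.card_cons, Multiset.prod_cons, pow_succ']
    exact (h a (Multiset.mem_cons_self _ _)).mul_mul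
      (ih fun b hb => h b (Multiset.mem_cons_of_mem hb))

/-! ### Split polynomials with roots in `S`. -/

section LinProd

variable {R : Type*} (K : Type*) [CommRing R] [IsDomain R] [Field K] [Algebra R K]
  [IsFractionRing R K] {S : Finset R}

/-- The split monic polynomial with roots in `S` and multiplicities `l`. -/
noncomputable def linProd (S : Finset R) (l : S → ℕ) : K[X] :=
  ∏ s : S, (X - C (algebraMap R K s)) ^ l s

theorem linProd_monic (l : S → ℕ) : (linProd K S l).Monic :=
  monic_prod_of_monic _ _ fun _ _ => (monic_X_sub_C _).pow _

theorem linProd_add (l l' : S → ℕ) : linProd K S (l + l') = linProd K S l * linProd K S l' := by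
  simp only [linProd, Pi.add_apply, pow_add, Finset.prod_mul_distrib]

theorem linProd_smul (n : ℕ) (l : S → ℕ) : linProd K S (n • l) = linProd K S l ^ n := by
  simp only [linProd, Pi.smul_apply, smul_eq_mul, mul_comm n, pow_mul, Finset.prod_pow]

theorem natDegree_C_mul_linProd {y : K} (hy : y ≠ 0) (l : S → ℕ) :
    (C y * linProd K S l).natDegree = ∑ s, l s := by
  rw [natDegree_C_mul hy, linProd, natDegree_prod_of_monic _ _ fun _ _ => (monic_X_sub_C _).pow _]
  simp

theorem C_mul_linProd_ne_zero {y : K} (hy : y ≠ 0) (l : S → ℕ) : C y * linProd K S l ≠ 0 :=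
  mul_ne_zero (by simpa using hy) (linProd_monic K l).ne_zero

theorem eval_linProd (l : S → ℕ) (a : R) :
    (linProd K S l).eval (algebraMap R K a) = algebraMap R K (∏ s : S, (a - s) ^ l s) := by
  simp [linProd, eval_prod]

theorem roots_linProd (l : S → ℕ) :
    (linProd K S l).roots = ∑ s, l s • ({algebraMap R K s} : Multiset K) := by
  have : ∏ s : S, (X - C (algebraMap R K s)) ^ l s ≠ 0 := (linProd_monic K l).ne_zero
  rw [linProd, roots_prod _ _ this]
  simp only [roots_pow, roots_X_sub_C]
  rfl

theorem count_roots_linProd (l : S → ℕ) (s : S) [DecidableEq K] :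
    (linProd K S l).roots.count (algebraMap R K s) = l s := by
  rw [roots_linProd, Multiset.count_sum', Finset.sum_eq_single_of_mem s (Finset.mem_univ _)]
  · simp
  · intro t _ ht
    rw [Multiset.count_nsmul, Multiset.count_singleton, if_neg, mul_zero]
    exact fun h => ht (Subtype.ext (IsFractionRing.injective R K h)).symm

variable {K}

theorem C_mul_linProd_inj {y y' : K} (hy : y ≠ 0) (hy' : y' ≠ 0) {l l' : S → ℕ}
    (h : C y * linProd K S l = C y' * linProd K S l') : y = y' ∧ l = l' := by
  classical
  constructor
  · simpa [(linProd_monic K l).leadingCoeff, (linProd_monic K l').leadingCoeff] using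
      congrArg leadingCoeff h
  · funext s
    have := congrArg (fun P => P.roots.count (algebraMap R K s)) h
    simp only [roots_C_mul _ hy, roots_C_mul _ hy', count_roots_linProd] at this
    exact this

/-- A divisor of a split polynomial splits, and its roots are among those of the product.
Factorizations are thereby reduced to constants and exponent vectors. -/
theorem exists_eq_C_mul_linProd_of_mul_eq {G H : K[X]} {x : K} (hx : x ≠ 0) {l : S → ℕ}
    (h : G * H = C x * linProd K S l) : ∃ y l', y ≠ 0 ∧ G = C y * linProd K S l' := by
  classical
  have h0 := C_mul_linProd_ne_zero K hx l
  have hG : G ≠ 0 := by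
    rintro rfl
    exact h0 (by rw [← h, zero_mul])
  have hsplit : (C x * linProd K S l).Splits :=
    (Splits.C x).mul (Splits.prod fun s _ => (Splits.X_sub_C _).pow _)
  have hGs := (hsplit.of_dvd h0 ⟨H, h.symm⟩).eq_prod_roots
  refine ⟨G.leadingCoeff, fun s => G.roots.count (algebraMap R K s), by simpa using hG, ?_⟩
  conv_lhs => rw [hGs]
  congr 1
  rw [Finset.prod_multiset_map_count, linProd]
  have hinj : Function.Injective fun s : S => algebraMap R K s :=
    (IsFractionRing.injective R K).comp Subtype.val_injective
  rw [← Finset.prod_image (s := Finset.univ) (g := fun s : S => algebraMap R K s)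
    (f := fun a => (X - C a) ^ G.roots.count a) hinj.injOn]
  refine Finset.prod_subset (fun a ha => ?_) fun a _ ha => ?_
  · rw [Multiset.mem_toFinset, mem_roots hG] at ha
    have ha' : a ∈ (C x * linProd K S l).roots := by
      rw [mem_roots h0, ← h]
      exact root_mul_right_of_isRoot _ ha
    rw [roots_C_mul _ hx, roots_linProd, Multiset.mem_sum] at ha'
    obtain ⟨s, -, hs⟩ := ha'
    rw [Multiset.mem_singleton.1 (Multiset.mem_of_mem_nsmul hs)]
    exact Finset.mem_image_of_mem _ (Finset.mem_univ s)
  · rw [Multiset.mem_toFinset] at ha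
    rw [Multiset.count_eq_zero_of_notMem ha, pow_zero]

end LinProd

/-! ### Membership in `Int(R)`, its units, and existence of factorizations. -/

section IntPoly

open IsDiscreteValuationRing

variable {R K : Type*} [CommRing R] [IsDomain R] [IsDiscreteValuationRing R] [Field K]
  [Algebra R K] [IsFractionRing R K] {π : R} {S : Finset R}

/-- The entry at `s` on the right is the minimal order of the values on the block of `s`, attained
on the subclass avoiding `S`; the blocks cover `R`. -/
theorem C_mul_linProd_mem_intPoly_iff (hπ : Irreducible π) {ρ : S → ℕ}
    (hρ : IsAssociatedPartition S ρ) {y : K} {z : ℤ} (hy : HasOrder π y z) (l : S → ℕ) :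
    C y * linProd K S l ∈ intPoly R K ↔
      ∀ s, 0 ≤ z + (blockMatrix S ρ).mulVec (fun t => (l t : ℤ)) s := by
  have heval : ∀ a : R, (C y * linProd K S l).eval (algebraMap R K a) =
      y * algebraMap R K (∏ t : S, (a - t) ^ l t) := fun a => by
    rw [eval_mul, eval_C, eval_linProd]
  have hnat : ∀ s, (blockMatrix S ρ).mulVec (fun t => (l t : ℤ)) s =
      ∑ t, (l t : ℤ) * ((blockMatrix S ρ s t).toNat : ℤ) := fun s =>
    Finset.sum_congr rfl fun t _ => by
      rw [Int.toNat_of_nonneg (blockMatrix_nonneg S ρ s t), mul_comm]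
  constructor
  · intro h s
    obtain ⟨r, hr, hr'⟩ := hρ.exists_poor s
    have h1 := h r
    rw [heval, map_prod] at h1
    refine ((hy.mul hπ ?_).mem_range_iff hπ).1 h1
    rw [hnat]
    refine HasOrder.prod hπ _ fun t _ => ?_
    rw [map_pow]
    exact (hasOrder_algebraMap hπ (addVal_sub_eq_blockMatrix S hr hr' t)).pow hπ _
  · intro h a
    obtain ⟨s, hs⟩ := hρ.exists_mem a
    -- Since `a` may be a root, the value need not have an order; only the guaranteed power of `π`
    -- is split off.
    choose q hq using fun t => (le_addVal_iff_pow_dvd hπ).1 (mem_nbhd_blockMatrix S hs t)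
    rw [heval]
    simp_rw [hq, mul_pow]
    rw [Finset.prod_mul_distrib, map_mul, ← mul_assoc]
    refine mul_mem (((hy.mul hπ ?_).mem_range_iff hπ).2 (h s)) ⟨_, rfl⟩
    rw [hnat, map_prod]
    refine HasOrder.prod hπ _ fun t _ => ?_
    rw [map_pow, map_pow]
    refine HasOrder.pow hπ ?_ _
    exact_mod_cast hasOrder_zpow (K := K) (π := π) ((blockMatrix S ρ s t).toNat : ℤ)

variable (K)

/-- The constant polynomials in `Int(R)`. -/
noncomputable def constHom : R →+* intPoly R K :=
  (C.comp (algebraMap R K)).codRestrict _ fun r a => by simp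

theorem coe_constHom (r : R) : (constHom K r : K[X]) = C (algebraMap R K r) := rfl

/-- Evaluation at an element of `R`. -/
noncomputable def evalAt (a : R) : intPoly R K →+* R :=
  ((RingEquiv.ofBijective (algebraMap R K).rangeRestrict
    ⟨fun _ _ h => IsFractionRing.injective R K (congrArg Subtype.val h),
      (algebraMap R K).rangeRestrict_surjective⟩).symm : (algebraMap R K).range →+* R).comp
    (((evalRingHom (algebraMap R K a)).comp (intPoly R K).subtype).codRestrict
      (algebraMap R K).range fun P => P.2 a)

theorem algebraMap_evalAt (a : R) (P : intPoly R K) :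
    algebraMap R K (evalAt K a P) = (P : K[X]).eval (algebraMap R K a) := by
  have := (RingEquiv.ofBijective (algebraMap R K).rangeRestrict
    ⟨fun _ _ h => IsFractionRing.injective R K (congrArg Subtype.val h),
      (algebraMap R K).rangeRestrict_surjective⟩).apply_symm_apply
      ⟨(P : K[X]).eval (algebraMap R K a), P.2 a⟩
  exact congrArg Subtype.val this

variable {K}

theorem natDegree_eq_zero_of_isUnit {P : intPoly R K} (h : IsUnit P) :
    (P : K[X]).natDegree = 0 :=
  Polynomial.natDegree_eq_zero_of_isUnit (h.map (intPoly R K).subtype)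

theorem not_isUnit_of_natDegree_pos {P : intPoly R K} (hP : 0 < (P : K[X]).natDegree) :
    ¬ IsUnit P := fun h => hP.ne' (natDegree_eq_zero_of_isUnit h)

theorem exists_evalAt_ne_zero {P : intPoly R K} (hP : P ≠ 0) : ∃ a : R, evalAt K a P ≠ 0 := by
  by_contra! h
  have : Infinite R := by
    by_contra hfin
    rw [not_infinite_iff_finite] at hfin
    exact IsDiscreteValuationRing.not_isField R (Finite.isField_of_domain R)
  refine hP (Subtype.ext (Polynomial.eq_zero_of_infinite_isRoot _ ?_))
  refine (Set.infinite_range_of_injective (IsFractionRing.injective R K)).mono ?_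
  rintro _ ⟨a, rfl⟩
  change (P : K[X]).eval _ = 0
  rw [← algebraMap_evalAt, h a, map_zero]

theorem isUnit_of_evalAt {P : intPoly R K} (hP : (P : K[X]).natDegree = 0) {a : R}
    (ha : IsUnit (evalAt K a P)) : IsUnit P := by
  obtain ⟨x, hx⟩ := natDegree_eq_zero.1 hP
  have : P = constHom K (evalAt K a P) := Subtype.ext (by
    rw [coe_constHom, algebraMap_evalAt, ← hx, eval_C])
  rw [this]
  exact ha.map _

/-- Fix `a` with `P(a) ≠ 0`. The quantity `deg P + v(P(a))` drops for proper divisors: a cofactor of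
degree zero whose value at `a` is a unit is itself a unit. -/
instance : WfDvdMonoid (intPoly R K) := by
  have key : ∀ (a : R) (n : ℕ) (P : intPoly R K), evalAt K a P ≠ 0 →
      (P : K[X]).natDegree + (addVal R (evalAt K a P)).toNat = n →
      Acc (DvdNotUnit (α := intPoly R K)) P := by
    intro a n
    induction n using Nat.strong_induction_on with
    | _ n ih =>
      intro P hP hn
      refine Acc.intro _ fun Q hQ => ?_
      obtain ⟨hQ0, T, hT, rfl⟩ := hQ
      rw [map_mul] at hP
      have hQe := left_ne_zero_of_mul hP
      have hTe := right_ne_zero_of_mul hP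
      have hT0 : (T : K[X]) ≠ 0 := by
        rintro h
        rw [show T = 0 from Subtype.ext h, map_zero] at hTe
        exact hTe rfl
      refine ih _ ?_ Q hQe rfl
      rw [← hn, map_mul, addVal_mul, ENat.toNat_add (mt addVal_eq_top_iff.1 hQe)
        (mt addVal_eq_top_iff.1 hTe), Subring.coe_mul,
        natDegree_mul (fun h => hQ0 (Subtype.ext h)) hT0]
      by_contra hle
      refine hT (isUnit_of_evalAt (a := a) (by omega) (addVal_eq_zero_iff.1 ?_))
      have h0 : (addVal R (evalAt K a T)).toNat = 0 := by omega
      exact (ENat.toNat_eq_zero.1 h0).resolve_right (mt addVal_eq_top_iff.1 hTe)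
  have key' : ∀ P : intPoly R K, P ≠ 0 → Acc (DvdNotUnit (α := intPoly R K)) P := fun P hP => by
    obtain ⟨a, ha⟩ := exists_evalAt_ne_zero hP
    exact key a _ P ha rfl
  refine ⟨⟨fun P => ?_⟩⟩
  by_cases hP : P = 0
  · exact Acc.intro _ fun Q hQ => key' Q hQ.1
  · exact key' P hP

end IntPoly

/-! ### Solutions of `B l = const` for a partition with one element of `S` per block. -/

section Kernel

open IsDiscreteValuationRing

variable {R : Type*} [CommRing R] [IsDomain R] [IsDiscreteValuationRing R] {S : Finset R}
  {ρ : S → ℕ}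

theorem blockMatrix_of_ne (h : ∀ s t : S, (t : R) ∈ nbhd (s : R) (ρ s) → t = s) {s t : S}
    (hst : t ≠ s) : (((blockMatrix S ρ s t).toNat : ℕ) : ℕ∞) = addVal R ((s : R) - t) ∧
      (blockMatrix S ρ s t).toNat < ρ s := by
  have hlt : addVal R ((s : R) - t) < ρ s := by
    by_contra! hle
    rw [AddValuation.map_sub_swap] at hle
    exact hst (h s t (mem_nbhd.2 hle))
  obtain ⟨b, hb, hb'⟩ := exists_blockMatrix_eq S ρ s t
  rw [min_eq_right hlt.le] at hb'
  rw [hb, Int.toNat_natCast, hb']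
  rw [← hb', Nat.cast_lt] at hlt
  exact ⟨rfl, hlt⟩

theorem blockMatrix_toNat_le (s t : S) : (blockMatrix S ρ s t).toNat ≤ ρ s := by
  obtain ⟨b, hb, hb'⟩ := exists_blockMatrix_eq S ρ s t
  rw [hb, Int.toNat_natCast, ← ENat.natCast_le_natCast, hb']
  exact min_le_left _ _

/-- If every block contains one element of `S` and is not all of `R`, the partition matrix is
nonsingular. -/
theorem eq_zero_of_blockMatrix_mulVec_eq_zero
    (h : ∀ s t : S, (t : R) ∈ nbhd (s : R) (ρ s) → t = s) (hpos : ∀ s, 0 < ρ s) (w : S → ℤ)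
    (hw : (blockMatrix S ρ).mulVec w = 0) : w = 0 := by
  have hself : ∀ s, (blockMatrix S ρ s s).toNat = ρ s := fun s => by simp [blockMatrix_self]
  refine eq_zero_of_sum_ultrametric_mul_eq_zero (fun s t => (blockMatrix S ρ s t).toNat) ?_ ?_ ?_ ?_
    w fun s => ?_
  · intro s t
    by_cases hst : t = s
    · rw [hst]
    · rw [← Nat.cast_inj (R := ℕ∞), (blockMatrix_of_ne h hst).1,
        (blockMatrix_of_ne h (Ne.symm hst)).1, AddValuation.map_sub_swap]
  · intro s t u
    by_cases hsu : u = s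
    · rw [hsu, hself]
      exact (min_le_left _ _).trans (blockMatrix_toNat_le s t)
    · by_cases hst : t = s
      · rw [hst]
        exact min_le_right _ _
      · by_cases htu : u = t
        · rw [htu]
          exact min_le_left _ _
        · rw [← ENat.natCast_le_natCast, Nat.mono_cast.map_min, (blockMatrix_of_ne h hst).1,
            (blockMatrix_of_ne h htu).1, (blockMatrix_of_ne h hsu).1,
            ← sub_add_sub_cancel (s : R) t u]
          exact addVal_add
  · intro s
    simpa only [hself] using hpos s
  · intro s t hst
    simpa only [hself] using (blockMatrix_of_ne h hst).2
  · simp only [Int.toNat_of_nonneg (blockMatrix_nonneg S ρ s _)]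
    exact congrFun hw s

/-- The vector `e l - z k` lies in the kernel of `B`, so `e l = z k`; as `k` has gcd one, `e`
divides `z`. -/
theorem eq_smul_of_blockMatrix_mulVec_eq_const
    (h : ∀ s t : S, (t : R) ∈ nbhd (s : R) (ρ s) → t = s) (hS : S.Nonempty) {k l : S → ℕ}
    (hk : ∀ s, 0 < k s) (hgcd : Finset.univ.gcd k = 1) {e z : ℤ}
    (he : ∀ s, (blockMatrix S ρ).mulVec (fun t => (k t : ℤ)) s = e)
    (hz : ∀ s, (blockMatrix S ρ).mulVec (fun t => (l t : ℤ)) s = z) :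
    ∃ j : ℕ, l = j • k ∧ z = j * e := by
  have : Nonempty S := hS.to_subtype
  obtain ⟨s₀⟩ := this
  by_cases hpos : ∀ s, 0 < ρ s
  · have hnn : ∀ (m : S → ℕ) (s t : S), 0 ≤ blockMatrix S ρ s t * (m t : ℤ) := fun m s t =>
      mul_nonneg (blockMatrix_nonneg S ρ s t) (Int.natCast_nonneg _)
    have he0 : 0 < e := by
      rw [← he s₀]
      refine Finset.sum_pos' (fun t _ => hnn k s₀ t) ⟨s₀, Finset.mem_univ _, ?_⟩
      change 0 < blockMatrix S ρ s₀ s₀ * (k s₀ : ℤ)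
      rw [blockMatrix_self]
      exact mul_pos (Int.natCast_pos.2 (hpos s₀)) (Int.natCast_pos.2 (hk s₀))
    have hz0 : 0 ≤ z := by
      rw [← hz s₀]
      exact Finset.sum_nonneg fun t _ => hnn l s₀ t
    have hw := eq_zero_of_blockMatrix_mulVec_eq_zero h hpos
      (e • (fun t => (l t : ℤ)) - z • fun t => (k t : ℤ)) (by
        rw [Matrix.mulVec_sub, Matrix.mulVec_smul, Matrix.mulVec_smul]
        funext s
        simp only [Pi.sub_apply, Pi.smul_apply, he, hz, smul_eq_mul, Pi.zero_apply]
        ring)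
    have hw' : ∀ s, e * l s = z * k s := fun s => by
      have := congrFun hw s
      simp only [Pi.sub_apply, Pi.smul_apply, smul_eq_mul, Pi.zero_apply] at this
      linarith
    lift e to ℕ using he0.le
    lift z to ℕ using hz0
    have hdvd : e ∣ z := by
      have h1 : e ∣ Finset.univ.gcd fun s => z * k s := Finset.dvd_gcd fun s _ =>
        ⟨l s, by exact_mod_cast (hw' s).symm⟩
      rwa [Finset.gcd_mul_left, hgcd, mul_one, normalize_eq] at h1
    obtain ⟨j, rfl⟩ := hdvd
    refine ⟨j, funext fun s => ?_, by push_cast; ring⟩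
    have h1 := hw' s
    rw [Nat.cast_mul, mul_assoc] at h1
    have h2 := mul_left_cancel₀ he0.ne' h1
    exact_mod_cast h2
  · push Not at hpos
    obtain ⟨s, hs⟩ := hpos
    -- Here the block of `s` is all of `R`, so `S = {s}`, `B = 0` and `k s = 1`.
    have hall : ∀ t, t = s := fun t => h s t (by rw [Nat.le_zero.1 hs]; simp [nbhd])
    have huniv : (Finset.univ : Finset S) = {s} := by
      ext t
      simpa using hall t
    have hks : k s = 1 := by
      rw [huniv, Finset.gcd_singleton] at hgcd
      simpa using hgcd
    have hrow : ∀ m : S → ℤ, (blockMatrix S ρ).mulVec m s = 0 := fun m => by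
      rw [Matrix.mulVec, dotProduct, huniv, Finset.sum_singleton, blockMatrix_self,
        Nat.le_zero.1 hs]
      simp
    refine ⟨l s, funext fun t => ?_, ?_⟩
    · rw [hall t]
      simp [hks]
    · rw [← he s, ← hz s, hrow, hrow, mul_zero]

end Kernel

/-! ### Factors of powers of `F` are powers of `F` up to units. -/

section Sufficiency

open IsDiscreteValuationRing

variable {R K : Type*} [CommRing R] [IsDomain R] [IsDiscreteValuationRing R] [Field K]
  [Algebra R K] [IsFractionRing R K] {π : R} {S : Finset R} {ρ : S → ℕ}

theorem natDegree_constHom_mul_pow (u : Rˣ) (F : intPoly R K) (j : ℕ) :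
    ((constHom K (u : R) * F ^ j : intPoly R K) : K[X]).natDegree = j * (F : K[X]).natDegree := by
  rw [Subring.coe_mul, coe_constHom, natDegree_C_mul (by simp), Subring.coe_pow, natDegree_pow]

theorem exists_eq_of_mul_eq_pow (hπ : Irreducible π) (hρ : IsAssociatedPartition S ρ)
    (h : ∀ s t : S, (t : R) ∈ nbhd (s : R) (ρ s) → t = s) (hS : S.Nonempty) {k : S → ℕ}
    (hk : ∀ s, 0 < k s) (hgcd : Finset.univ.gcd k = 1) {e : ℤ}
    (he : ∀ s, (blockMatrix S ρ).mulVec (fun t => (k t : ℤ)) s = e) {y₀ : K}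
    (hy₀ : HasOrder π y₀ (-e)) {F : intPoly R K} (hF : (F : K[X]) = C y₀ * linProd K S k)
    {G H : intPoly R K} {n : ℕ} (hGH : G * H = F ^ n) :
    ∃ (u : Rˣ) (j : ℕ), G = constHom K (u : R) * F ^ j := by
  have hpow : ∀ j : ℕ, ((F ^ j : intPoly R K) : K[X]) = C (y₀ ^ j) * linProd K S (j • k) :=
    fun j => by rw [Subring.coe_pow, hF, mul_pow, linProd_smul, C_pow]
  have hy₀0 := hy₀.ne_zero hπ
  have hGH' : (G : K[X]) * (H : K[X]) = C (y₀ ^ n) * linProd K S (n • k) := by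
    rw [← hpow, ← hGH, Subring.coe_mul]
  obtain ⟨y, l, hy, hG⟩ := exists_eq_C_mul_linProd_of_mul_eq (pow_ne_zero n hy₀0) hGH'
  obtain ⟨y', l', hy', hH⟩ := exists_eq_C_mul_linProd_of_mul_eq (pow_ne_zero n hy₀0)
    ((mul_comm _ _).trans hGH')
  rw [hG, hH, mul_mul_mul_comm, ← C_mul, ← linProd_add] at hGH'
  obtain ⟨hyy, hll⟩ := C_mul_linProd_inj (mul_ne_zero hy hy') (pow_ne_zero n hy₀0) hGH'
  obtain ⟨z, hz⟩ := exists_hasOrder hπ hy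
  obtain ⟨z', hz'⟩ := exists_hasOrder hπ hy'
  have hzz : z + z' = n * -e := (hz.mul hπ hz').unique hπ (hyy ▸ hy₀.pow hπ n)
  have hGl := (C_mul_linProd_mem_intPoly_iff hπ hρ hz l).1 (hG ▸ G.2)
  have hHl := (C_mul_linProd_mem_intPoly_iff hπ hρ hz' l').1 (hH ▸ H.2)
  have hsum : ∀ s, (blockMatrix S ρ).mulVec (fun t => (l t : ℤ)) s +
      (blockMatrix S ρ).mulVec (fun t => (l' t : ℤ)) s = n * e := fun s => by
    rw [← he s, ← Pi.add_apply, ← Matrix.mulVec_add, ← smul_eq_mul, ← Pi.smul_apply,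
      ← Matrix.mulVec_smul]
    congr 2
    funext t
    have := congrFun hll t
    simp only [Pi.add_apply, Pi.smul_apply, smul_eq_mul] at this ⊢
    exact_mod_cast this
  -- Two families of nonnegative numbers with sum zero both vanish, so `B l` is the constant vector
  -- `-z`.
  obtain ⟨j, rfl, hj⟩ := eq_smul_of_blockMatrix_mulVec_eq_const (l := l) (z := -z) h hS hk hgcd he
    fun s => by
      have h1 := hGl s
      have h2 := hHl s
      have h3 := hsum s
      linarith
  have hq : HasOrder π (y * (y₀ ^ j)⁻¹) 0 := by
    have := hz.mul hπ (hy₀.pow hπ j).inv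
    rwa [show z + -((j : ℤ) * -e) = 0 by linarith] at this
  obtain ⟨u, hu⟩ := hq.exists_unit
  refine ⟨u, j, Subtype.ext ?_⟩
  rw [Subring.coe_mul, hpow, coe_constHom, hG, ← mul_assoc, ← C_mul, ← hu,
    inv_mul_cancel_right₀ (pow_ne_zero j hy₀0)]

/-- An irreducible of the form `u F ^ j` must have `j = 1`, and comparing degrees fixes the number
of factors. -/
theorem isAbsolutelyIrreducible_of_forall_mul_eq_pow {F : intPoly R K}
    (hF : 0 < (F : K[X]).natDegree)
    (h : ∀ (G H : intPoly R K) (n : ℕ), G * H = F ^ n →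
      ∃ (u : Rˣ) (j : ℕ), G = constHom K (u : R) * F ^ j) : IsAbsolutelyIrreducible F := by
  have hconst : ∀ u : Rˣ, IsUnit (constHom K (u : R)) := fun u => u.isUnit.map _
  have hirr : Irreducible F := by
    refine ⟨not_isUnit_of_natDegree_pos hF, fun G H hGH => ?_⟩
    obtain ⟨u, i, rfl⟩ := h G H 1 (by rw [pow_one, hGH])
    obtain ⟨v, j, rfl⟩ := h H _ 1 (by rw [pow_one, mul_comm]; exact hGH.symm)
    have hdeg := congrArg (fun P : intPoly R K => (P : K[X]).natDegree) hGH
    rw [show constHom K (u : R) * F ^ i * (constHom K (v : R) * F ^ j) =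
      constHom K ((u * v : Rˣ) : R) * F ^ (i + j) by rw [Units.val_mul, map_mul, pow_add]; ring,
      natDegree_constHom_mul_pow] at hdeg
    have hij : i + j = 1 := (Nat.eq_of_mul_eq_mul_right hF (by rw [one_mul]; exact hdeg)).symm
    rcases Nat.eq_zero_or_pos i with rfl | hi
    · exact Or.inl (by simpa using hconst u)
    · obtain rfl : j = 0 := by omega
      exact Or.inr (by simpa using hconst v)
  have hassoc : ∀ (n : ℕ) (p : Multiset (intPoly R K)), (∀ b ∈ p, Irreducible b) →
      p.prod = F ^ n → ∀ b ∈ p, Associated F b := by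
    intro n p hp hprod b hb
    obtain ⟨H, hH⟩ := Multiset.dvd_prod hb
    obtain ⟨u, j, rfl⟩ := h b H n (by rw [← hprod, hH])
    have hj : j = 1 := by
      rcases j with _ | _ | j
      · exact ((hp _ hb).not_isUnit (by simpa using hconst u)).elim
      · rfl
      · rcases (hp _ hb).isUnit_or_isUnit
          (show _ = (constHom K (u : R) * F ^ (j + 1)) * F by rw [pow_succ, mul_assoc]) with h1 | h1
        · refine (not_isUnit_of_natDegree_pos ?_ h1).elim
          rw [natDegree_constHom_mul_pow]
          positivity
        · exact (hirr.not_isUnit h1).elim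
    rw [hj, pow_one]
    exact associated_unit_mul_right F _ (hconst u)
  have hdeg : ∀ (n : ℕ) (p : Multiset (intPoly R K)), (∀ b ∈ p, Irreducible b) →
      p.prod = F ^ n → p.card = n := by
    intro n p hp hprod
    have h1 := (associated_pow_card_prod (hassoc n p hp hprod)).symm
    rw [hprod] at h1
    obtain ⟨v, hv⟩ := h1
    have h2 := congrArg (fun P : intPoly R K => (P : K[X]).natDegree) hv
    have hF0 : (F : K[X]) ≠ 0 := ne_zero_of_natDegree_gt hF
    have hv0 : ((v : intPoly R K) : K[X]) ≠ 0 := fun h0 => v.ne_zero (Subtype.ext h0)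
    simp only [Subring.coe_mul, Subring.coe_pow] at h2
    rw [natDegree_mul (pow_ne_zero _ hF0) hv0, natDegree_eq_zero_of_isUnit v.isUnit, add_zero,
      natDegree_pow, natDegree_pow] at h2
    exact (Nat.eq_of_mul_eq_mul_right hF h2).symm
  refine ⟨hirr, fun n _ p q hp hq hpn hqn => Multiset.rel_of_forall (fun a b ha hb => ?_) ?_⟩
  · exact (hassoc n p hp hpn a ha).symm.trans (hassoc n q hq hqn b hb)
  · rw [hdeg n p hp hpn, hdeg n q hq hqn]

end Sufficiency

/-! ### The constant as a generator of the fixed divisor. -/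

section FixedDivisor

variable {R K : Type*} [CommRing R] [IsDomain R] [IsDiscreteValuationRing R] [Field K]
  [Algebra R K] [IsFractionRing R K]

theorem C_mul_map_mem_intPoly_iff {y : K} {f : R[X]} :
    C y * f.map (algebraMap R K) ∈ intPoly R K ↔
      ∀ x ∈ fixedDivisor f, y * algebraMap R K x ∈ (algebraMap R K).range := by
  have heval : ∀ a : R, (C y * f.map (algebraMap R K)).eval (algebraMap R K a) =
      y * algebraMap R K (f.eval a) := fun a => by
    rw [eval_mul, eval_C, eval_map_algebraMap, aeval_algebraMap_apply, coe_aeval_eq_eval]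
  constructor
  · intro h x hx
    induction hx using Submodule.span_induction with
    | mem x hx =>
      obtain ⟨a, rfl⟩ := hx
      have := h a
      rwa [heval] at this
    | zero => rw [map_zero, mul_zero]; exact zero_mem _
    | add x y _ _ hx hy => rw [map_add, mul_add]; exact add_mem hx hy
    | smul a x _ hx =>
      rw [smul_eq_mul, map_mul, mul_left_comm]
      exact mul_mem ⟨a, rfl⟩ hx
  · intro h a
    rw [heval]
    exact h _ (Ideal.subset_span ⟨a, rfl⟩)

theorem evalAt_constHom (a r : R) : evalAt K a (constHom K r) = r :=
  IsFractionRing.injective R K (by rw [algebraMap_evalAt, coe_constHom, eval_C])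

theorem isUnit_of_isUnit_constHom {r : R} (h : IsUnit (constHom K r)) : IsUnit r := by
  have := h.map (evalAt K 0)
  rwa [evalAt_constHom] at this

/-- If `g = c r` generates the fixed divisor, then `f / g` is integer-valued and `F = r (f / g)`.
The second factor is not constant, so irreducibility makes `r` a unit. -/
theorem exists_fixedDivisor_eq_span {c : K} (hc : c ≠ 0) {f : R[X]} {F : intPoly R K}
    (hF : (F : K[X]) = C c⁻¹ * f.map (algebraMap R K)) (hdeg : 0 < (F : K[X]).natDegree)
    (hirr : Irreducible F) :
    ∃ d : R, algebraMap R K d = c ∧ fixedDivisor f = Ideal.span {d} := by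
  obtain ⟨g, hg⟩ := (IsPrincipalIdealRing.principal (fixedDivisor f)).principal
  change _ = Ideal.span {g} at hg
  have hmem := C_mul_map_mem_intPoly_iff.1 (hF ▸ F.2)
  obtain ⟨r, hr⟩ := hmem g (hg ▸ Ideal.mem_span_singleton_self g)
  have hcr : c * algebraMap R K r = algebraMap R K g := by rw [hr, mul_inv_cancel_left₀ hc]
  have hg0 : algebraMap R K g ≠ 0 := by
    intro h0
    rw [IsFractionRing.to_map_eq_zero_iff] at h0
    obtain ⟨a, ha⟩ := exists_evalAt_ne_zero hirr.ne_zero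
    have hfa : f.eval a ∈ fixedDivisor f := Ideal.subset_span ⟨a, rfl⟩
    rw [hg, h0, Ideal.mem_span_singleton, zero_dvd_iff] at hfa
    refine ha (IsFractionRing.injective R K ?_)
    rw [algebraMap_evalAt, hF, eval_mul, eval_map_algebraMap, aeval_algebraMap_apply,
      coe_aeval_eq_eval, hfa, map_zero, mul_zero]
  have hG : C (algebraMap R K g)⁻¹ * f.map (algebraMap R K) ∈ intPoly R K := by
    refine C_mul_map_mem_intPoly_iff.2 fun x hx => ?_
    rw [hg, Ideal.mem_span_singleton] at hx
    obtain ⟨q, rfl⟩ := hx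
    exact ⟨q, by rw [map_mul, inv_mul_cancel_left₀ hg0]⟩
  have hFG : F = constHom K r * ⟨_, hG⟩ := Subtype.ext (by
    rw [Subring.coe_mul, coe_constHom, hF, ← mul_assoc, ← C_mul, ← hcr, mul_inv, mul_comm c⁻¹,
      mul_inv_cancel_left₀ (right_ne_zero_of_mul (hcr.trans_ne hg0))])
  rcases hirr.isUnit_or_isUnit hFG with h | h
  · obtain ⟨u, rfl⟩ := isUnit_of_isUnit_constHom h
    refine ⟨g * (u⁻¹ : Rˣ), ?_, ?_⟩
    · rw [map_mul, ← hcr, mul_assoc, ← map_mul, Units.mul_inv, map_one, mul_one]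
    · rw [hg, Ideal.span_singleton_eq_span_singleton]
      exact associated_mul_unit_right g _ u⁻¹.isUnit
  · have h1 := natDegree_eq_zero_of_isUnit h
    rw [natDegree_C_mul (inv_ne_zero hg0)] at h1
    rw [hF, natDegree_C_mul (inv_ne_zero hc)] at hdeg
    exact absurd h1 hdeg.ne'

end FixedDivisor

/-! ### Consequences of absolute irreducibility for the matrix `B`. -/

section Necessity

variable {R K : Type*} [CommRing R] [IsDomain R] [IsDiscreteValuationRing R] [Field K]
  [Algebra R K] [IsFractionRing R K] {π : R} {S : Finset R} {ρ : S → ℕ}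

theorem FactorsUniquely.exists_associated_pow {D : Type*} [CommRing D] [IsDomain D] [WfDvdMonoid D]
    {F G H : D} (hF : Irreducible F) {n : ℕ} (h : FactorsUniquely (F ^ n)) (hG : ¬ IsUnit G)
    (hH : ¬ IsUnit H) (hGH : G * H = F ^ n) : ∃ j, Associated (F ^ j) G := by
  have h0 : G * H ≠ 0 := hGH ▸ pow_ne_zero n hF.ne_zero
  obtain ⟨p, hp, rfl, -⟩ :=
    (WfDvdMonoid.not_isUnit_iff_exists_factors_eq G (left_ne_zero_of_mul h0)).1 hG
  obtain ⟨q, hq, rfl, -⟩ :=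
    (WfDvdMonoid.not_isUnit_iff_exists_factors_eq H (right_ne_zero_of_mul h0)).1 hH
  have hrel := h (p + q) (Multiset.replicate n F)
    (fun b hb => (Multiset.mem_add.1 hb).elim (hp b) (hq b))
    (fun b hb => Multiset.eq_of_mem_replicate hb ▸ hF) (by rw [Multiset.prod_add, hGH])
    (Multiset.prod_replicate n F)
  have hall := (Multiset.rel_replicate_right.1 hrel).2
  exact ⟨p.card, associated_pow_card_prod fun b hb =>
    (hall b (Multiset.mem_add.2 (Or.inl hb))).symm⟩

theorem le_blockMatrix_mulVec (hπ : Irreducible π) (hρ : IsAssociatedPartition S ρ) {m : S → ℕ}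
    {e : ℤ} {y₀ : K} (hy₀ : HasOrder π y₀ (-e)) {F : intPoly R K}
    (hF : (F : K[X]) = C y₀ * linProd K S m) (s : S) :
    e ≤ (blockMatrix S ρ).mulVec (fun t => (m t : ℤ)) s := by
  have := (C_mul_linProd_mem_intPoly_iff hπ hρ hy₀ m).1 (hF ▸ F.2) s
  linarith

/-- Perturbation argument: `n m + w` and `n m - w`, both with constant `y₀ ^ n`, define nonunits
with product `F ^ (2 * n)`. Unique factorization makes each associated to a power of `F`. -/
theorem exists_eq_smul_of_blockMatrix_mulVec_eq_zero (hπ : Irreducible π)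
    (hρ : IsAssociatedPartition S ρ) (hS : S.Nonempty) {m : S → ℕ} (hm : ∀ s, 0 < m s)
    {e : ℤ} {y₀ : K} (hy₀ : HasOrder π y₀ (-e)) {F : intPoly R K}
    (hF : (F : K[X]) = C y₀ * linProd K S m) (habs : IsAbsolutelyIrreducible F) (w : S → ℤ)
    (hw : ∀ s, (blockMatrix S ρ).mulVec (fun t => (m t : ℤ)) s = e →
      (blockMatrix S ρ).mulVec w s = 0) : ∃ j : ℤ, ∀ s, w s = j * m s := by
  have : Nonempty S := hS.to_subtype
  set B := blockMatrix S ρ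
  have hy₀0 := hy₀.ne_zero hπ
  -- The bound on `w` keeps the exponents positive; the bound on `B w` lets the slack of the
  -- non-tight rows absorb the perturbation.
  obtain ⟨n, hn1, hnw, hnB⟩ : ∃ n : ℕ, 1 ≤ n ∧ (∀ s, |w s| < n) ∧ ∀ s, |B.mulVec w s| ≤ n := by
    obtain ⟨s, hs⟩ := Finite.exists_max fun s => |w s|
    obtain ⟨t, ht⟩ := Finite.exists_max fun s => |B.mulVec w s|
    have h1 := abs_nonneg (w s)
    have h2 := abs_nonneg (B.mulVec w t)
    refine ⟨(|w s| + |B.mulVec w t| + 1).toNat, by omega, fun i => ?_, fun i => ?_⟩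
    · have := hs i
      omega
    · have := ht i
      omega
  have hlt : ∀ s, |w s| < n * m s := fun s => (hnw s).trans_le
    (le_mul_of_one_le_right (Int.natCast_nonneg n) (by exact_mod_cast hm s))
  have hmem : ∀ (x : S → ℤ) (l : S → ℕ), (x = w ∨ x = -w) → (∀ s, (l s : ℤ) = n * m s + x s) →
      C (y₀ ^ n) * linProd K S l ∈ intPoly R K := by
    intro x l hx hl
    have hyn := hy₀.pow hπ n
    refine (C_mul_linProd_mem_intPoly_iff hπ hρ hyn l).2 fun s => ?_
    have hBl : B.mulVec (fun t => (l t : ℤ)) s =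
        n * B.mulVec (fun t => (m t : ℤ)) s + B.mulVec x s := by
      rw [← smul_eq_mul, ← Pi.smul_apply, ← Matrix.mulVec_smul, ← Pi.add_apply, ← Matrix.mulVec_add]
      congr 2
      funext t
      exact hl t
    change 0 ≤ _ + B.mulVec _ s
    rw [hBl]
    have hBx : |B.mulVec x s| = |B.mulVec w s| := by
      rcases hx with rfl | rfl
      · rfl
      · rw [Matrix.mulVec_neg, Pi.neg_apply, abs_neg]
    -- Tight rows do not see the perturbation; any other row has integer slack at least one, which
    -- `n` copies of `m` amplify to at least `n`.
    have hle := le_blockMatrix_mulVec hπ hρ hy₀ hF s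
    rcases hle.eq_or_lt with heq | hlt
    · rw [hw s heq.symm, abs_zero, abs_eq_zero] at hBx
      rw [hBx, ← heq]
      linarith
    · have h1 := neg_abs_le (B.mulVec x s)
      have h2 := hnB s
      have h3 : (n : ℤ) * (e + 1) ≤ n * B.mulVec (fun t => (m t : ℤ)) s :=
        mul_le_mul_of_nonneg_left hlt (Int.natCast_nonneg n)
      linarith
  choose l hl using fun s => Int.eq_ofNat_of_zero_le (a := n * m s + w s) (by
    have := neg_abs_le (w s); have := hlt s; linarith)
  choose l' hl' using fun s => Int.eq_ofNat_of_zero_le (a := n * m s + (-w) s) (by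
    rw [Pi.neg_apply]; have := le_abs_self (w s); have := hlt s; linarith)
  have hG := hmem w l (Or.inl rfl) fun s => (hl s).symm
  have hH := hmem (-w) l' (Or.inr rfl) fun s => (hl' s).symm
  have hpos : ∀ k : S → ℕ, (∀ s, 0 < k s) → 0 < (C (y₀ ^ n) * linProd K S k).natDegree :=
    fun k hk => by
      rw [natDegree_C_mul_linProd K (pow_ne_zero n hy₀0)]
      exact Finset.sum_pos (fun s _ => hk s) Finset.univ_nonempty
  have hGu : ¬ IsUnit (⟨_, hG⟩ : intPoly R K) := not_isUnit_of_natDegree_pos (hpos l fun s => by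
    have h1 := hl s; have := neg_abs_le (w s); have := hlt s; omega)
  have hHu : ¬ IsUnit (⟨_, hH⟩ : intPoly R K) := not_isUnit_of_natDegree_pos (hpos l' fun s => by
    have h1 := hl' s; rw [Pi.neg_apply] at h1
    have := le_abs_self (w s); have := hlt s; omega)
  have hprod : (⟨_, hG⟩ * ⟨_, hH⟩ : intPoly R K) = F ^ (2 * n) := Subtype.ext (by
    rw [Subring.coe_mul, Subring.coe_pow, hF, mul_mul_mul_comm, ← C_mul, ← linProd_add, mul_pow,
      ← linProd_smul, ← C_pow, ← pow_add, two_mul]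
    congr 2
    funext s
    have h1 := hl s
    have h2 := hl' s
    rw [Pi.neg_apply] at h2
    simp only [Pi.add_apply, Pi.smul_apply, smul_eq_mul]
    zify
    rw [← h1, ← h2]
    ring)
  obtain ⟨j, v, hv⟩ :=
    (habs.2 (2 * n) (by omega)).exists_associated_pow habs.1 hGu hHu hprod
  obtain ⟨x, hx⟩ := natDegree_eq_zero.1 (natDegree_eq_zero_of_isUnit v.isUnit)
  have hx0 : x ≠ 0 := by
    rintro rfl
    exact v.ne_zero (Subtype.ext (by rw [← hx, C_0]; rfl))
  have hv' := congrArg Subtype.val hv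
  rw [Subring.coe_mul, Subring.coe_pow, ← hx, hF, mul_pow, ← linProd_smul, ← C_pow,
    mul_right_comm, ← C_mul] at hv'
  obtain ⟨-, hlj⟩ := C_mul_linProd_inj (mul_ne_zero (pow_ne_zero j hy₀0) hx0)
    (pow_ne_zero n hy₀0) hv'
  refine ⟨j - n, fun s => ?_⟩
  have h1 := hl s
  rw [← congrFun hlj s, Pi.smul_apply, smul_eq_mul] at h1
  push_cast at h1
  linarith

/-- If every row had slack, `F / π` would be integer-valued and `F = π (F / π)` a proper
factorization. -/
theorem exists_blockMatrix_mulVec_eq (hπ : Irreducible π)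
    (hρ : IsAssociatedPartition S ρ) (hS : S.Nonempty) {m : S → ℕ} (hm : ∀ s, 0 < m s)
    {e : ℤ} {y₀ : K} (hy₀ : HasOrder π y₀ (-e)) {F : intPoly R K}
    (hF : (F : K[X]) = C y₀ * linProd K S m) (hirr : Irreducible F) :
    ∃ s, (blockMatrix S ρ).mulVec (fun t => (m t : ℤ)) s = e := by
  have : Nonempty S := hS.to_subtype
  by_contra! hne
  have hp := algebraMap_ne_zero_of_irreducible (K := K) hπ
  have hy := hy₀.mul hπ (hasOrder_zpow (K := K) (π := π) (-1))
  have hG := (C_mul_linProd_mem_intPoly_iff hπ hρ hy m).2 fun s => by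
    have h1 := le_blockMatrix_mulVec hπ hρ hy₀ hF s
    have h2 := lt_of_le_of_ne h1 (hne s).symm
    omega
  have hFG : F = constHom K π * ⟨_, hG⟩ := Subtype.ext (by
    rw [Subring.coe_mul, coe_constHom, hF, ← mul_assoc, ← C_mul, zpow_neg_one, mul_left_comm,
      mul_inv_cancel₀ hp, mul_one])
  rcases hirr.isUnit_or_isUnit hFG with h | h
  · exact hπ.not_isUnit (isUnit_of_isUnit_constHom h)
  · refine not_isUnit_of_natDegree_pos ?_ h
    rw [natDegree_C_mul_linProd K (hy.ne_zero hπ)]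
    exact Finset.sum_pos (fun s _ => hm s) Finset.univ_nonempty

theorem IsAbsolutelyIrreducible.blockMatrix_mulVec_eq (hπ : Irreducible π)
    (hρ : IsAssociatedPartition S ρ)
    (hρ' : ∀ s t : S, (t : R) ∈ nbhd (s : R) (ρ s) → ρ t = ρ s)
    (hS : S.Nonempty) {m : S → ℕ} (hm : ∀ s, 0 < m s)
    {e : ℤ} {y₀ : K} (hy₀ : HasOrder π y₀ (-e)) {F : intPoly R K}
    (hF : (F : K[X]) = C y₀ * linProd K S m) (habs : IsAbsolutelyIrreducible F) :
    (∀ s, (blockMatrix S ρ).mulVec (fun t => (m t : ℤ)) s = e) ∧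
      ∀ s t : S, (t : R) ∈ nbhd (s : R) (ρ s) → t = s := by
  classical
  obtain ⟨s₀, hs₀⟩ := exists_blockMatrix_mulVec_eq hπ hρ hS hm hy₀ hF habs.1
  have hsplit := exists_eq_smul_of_blockMatrix_mulVec_eq_zero hπ hρ hS hm hy₀ hF habs
  -- For `e = 0` the vector `m` itself may lie in the kernel. A tight row then forces `ρ = 0` and `B
  -- = 0`, so every `w` is a multiple of `m`, whence `S` is a singleton.
  by_cases he : e = 0
  · have hρ0 : ρ s₀ = 0 := by
      have h1 := (Finset.sum_eq_zero_iff_of_nonneg fun t _ => mul_nonneg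
        (blockMatrix_nonneg S ρ s₀ t) (Int.natCast_nonneg (m t))).1 (hs₀.trans he) s₀
        (Finset.mem_univ _)
      rw [blockMatrix_self] at h1
      have := hm s₀
      rcases mul_eq_zero.1 h1 with h | h <;> omega
    have hall : ∀ s t, blockMatrix S ρ s t = 0 := fun s t => by
      have h1 := hρ' s₀ s (by rw [hρ0]; simp [nbhd])
      obtain ⟨b, hb, hb'⟩ := exists_blockMatrix_eq S ρ s t
      rw [h1, hρ0, Nat.cast_zero, zero_min] at hb'
      rw [hb]
      exact_mod_cast hb'
    have hsub : ∀ s, s = s₀ := by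
      obtain ⟨j, hj⟩ := hsplit (Pi.single s₀ 1) fun s _ => by
        rw [show blockMatrix S ρ = 0 from Matrix.ext hall, Matrix.zero_mulVec, Pi.zero_apply]
      intro s
      by_contra hs
      have h1 := hj s₀
      have h2 := hj s
      rw [Pi.single_eq_same] at h1
      rw [Pi.single_eq_of_ne hs] at h2
      have := hm s
      rcases mul_eq_zero.1 h2.symm with h | h
      · rw [h, zero_mul] at h1
        exact one_ne_zero h1
      · omega
    exact ⟨fun s => hsub s ▸ hs₀, fun s t _ => (hsub t).trans (hsub s).symm⟩
  -- `M` is `B` with its non-tight rows erased. A kernel vector is `j m`, and a tight row gives `j e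
  -- = 0`, so `M` has no zero row and no repeated row.
  · let M : Matrix S S ℤ := Matrix.of fun s t =>
      if (blockMatrix S ρ).mulVec (fun t => (m t : ℤ)) s = e then blockMatrix S ρ s t else 0
    have hdet : M.det ≠ 0 := by
      intro hdet
      obtain ⟨w, hw0, hw⟩ := Matrix.exists_mulVec_eq_zero_iff.2 hdet
      have hrow : ∀ s, (blockMatrix S ρ).mulVec (fun t => (m t : ℤ)) s = e →
          (blockMatrix S ρ).mulVec w s = 0 := fun s hs => by
        refine Eq.trans ?_ (congrFun hw s)
        exact Finset.sum_congr rfl fun t _ => by simp only [M, Matrix.of_apply, if_pos hs]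
      obtain ⟨j, hj⟩ := hsplit w hrow
      have h1 := hrow s₀ hs₀
      rw [show w = j • fun s => (m s : ℤ) from funext hj, Matrix.mulVec_smul, Pi.smul_apply, hs₀,
        smul_eq_mul] at h1
      have hj0 : j = 0 := (mul_eq_zero.1 h1).resolve_right he
      exact hw0 (funext fun s => by rw [hj s, hj0, zero_mul, Pi.zero_apply])
    have hall : ∀ s, (blockMatrix S ρ).mulVec (fun t => (m t : ℤ)) s = e := by
      by_contra! hne
      obtain ⟨s, hs⟩ := hne
      exact hdet (Matrix.det_eq_zero_of_row_eq_zero s fun t => by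
        simp only [M, Matrix.of_apply, if_neg hs])
    refine ⟨hall, fun s t hst => ?_⟩
    by_contra hne
    refine hdet (Matrix.det_zero_of_row_eq hne (funext fun u => ?_))
    simp only [M, Matrix.of_apply, hall, if_true, blockMatrix_row_eq S hst (hρ' s t hst)]

/-- Dividing `m` by its gcd `g` keeps `B m` constant, so the quotient vector with its best constant
gives an element of `Int(R)` whose `g`-th power is `F` up to a unit. -/
theorem gcd_eq_one_of_irreducible (hπ : Irreducible π)
    (hρ : IsAssociatedPartition S ρ) (hS : S.Nonempty) {m : S → ℕ} (hm : ∀ s, 0 < m s)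
    {e : ℤ} {y₀ : K} (hy₀ : HasOrder π y₀ (-e)) {F : intPoly R K}
    (hF : (F : K[X]) = C y₀ * linProd K S m) (hirr : Irreducible F)
    (he : ∀ s, (blockMatrix S ρ).mulVec (fun t => (m t : ℤ)) s = e) :
    Finset.univ.gcd m = 1 := by
  have : Nonempty S := hS.to_subtype
  obtain ⟨s₀⟩ := id this
  obtain ⟨k, hk, -⟩ := Finset.extract_gcd m (Finset.univ_nonempty (α := S))
  set g := Finset.univ.gcd m
  have hmk : m = g • k := funext fun s => hk s (Finset.mem_univ s)
  have hg0 : 0 < g := Nat.pos_of_ne_zero fun h0 => (hm s₀).ne' (by rw [hmk, h0, zero_smul]; rfl)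
  have hkpos : ∀ s, 0 < k s := fun s => Nat.pos_of_ne_zero fun h0 => (hm s).ne' (by
    rw [hmk, Pi.smul_apply, h0, smul_zero])
  have hBk : ∀ s, (g : ℤ) * (blockMatrix S ρ).mulVec (fun t => (k t : ℤ)) s = e := fun s => by
    rw [← he s, ← smul_eq_mul, ← Pi.smul_apply, ← Matrix.mulVec_smul]
    congr 2
    funext t
    simp [hmk]
  set e' := (blockMatrix S ρ).mulVec (fun t => (k t : ℤ)) s₀
  have hconst : ∀ s, (blockMatrix S ρ).mulVec (fun t => (k t : ℤ)) s = e' := fun s =>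
    mul_left_cancel₀ (Int.natCast_ne_zero.2 hg0.ne') ((hBk s).trans (hBk s₀).symm)
  have hy := hasOrder_zpow (K := K) (π := π) (-e')
  have hG := (C_mul_linProd_mem_intPoly_iff hπ hρ hy k).2 fun s => by
    rw [hconst s, neg_add_cancel]
  have hy0 := hy.ne_zero hπ
  obtain ⟨u, hu⟩ := HasOrder.exists_unit (π := π) (x := y₀ * ((algebraMap R K π ^ (-e')) ^ g)⁻¹) (by
    have h1 := hy₀.mul hπ (hy.pow hπ g).inv
    rwa [show -e + -((g : ℤ) * -e') = 0 by rw [← hBk s₀]; ring] at h1)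
  have hFG : F = constHom K (u : R) * (⟨_, hG⟩ : intPoly R K) ^ g := Subtype.ext (by
    rw [Subring.coe_mul, coe_constHom, Subring.coe_pow, hF, mul_pow, ← linProd_smul, ← hmk,
      ← mul_assoc, ← C_pow, ← C_mul, ← hu, inv_mul_cancel_right₀ (pow_ne_zero g hy0)])
  have hGu : ¬ IsUnit (⟨_, hG⟩ : intPoly R K) := not_isUnit_of_natDegree_pos (by
    rw [natDegree_C_mul_linProd K hy0]
    exact Finset.sum_pos (fun s _ => hkpos s) Finset.univ_nonempty)
  obtain ⟨i, hi⟩ : ∃ i, g = i + 1 := ⟨g - 1, by omega⟩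
  rw [hi, pow_succ, ← mul_assoc] at hFG
  rcases hirr.isUnit_or_isUnit hFG with h | h
  · rcases Nat.eq_zero_or_pos i with h0 | h0
    · rw [hi, h0]
    · exact (hGu ((isUnit_pow_iff h0.ne').1 (isUnit_of_mul_isUnit_right h))).elim
  · exact (hGu h).elim

end Necessity

end IntegerValued

/-! ### The main equivalence. -/

theorem theorem2 {R K : Type*} [CommRing R] [IsDomain R] [IsDiscreteValuationRing R]
    [Finite (IsLocalRing.ResidueField R)] [Field K] [Algebra R K] [IsFractionRing R K]
    (S : Finset R) (hS : S.Nonempty) (m : S → ℕ) (hm : ∀ s, 0 < m s)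
    (c : K) (hc : c ≠ 0)
    (f : R[X]) (hf : f = ∏ s : S, (X - C (s : R)) ^ m s)
    (F : K[X]) (hF : F = C c⁻¹ * f.map (algebraMap R K)) :
    (∃ h : F ∈ IntegerValued.intPoly R K,
        IntegerValued.IsAbsolutelyIrreducible (⟨F, h⟩ : IntegerValued.intPoly R K)) ↔
      IntegerValued.IsBalanced S ∧
      IntegerValued.IsEqualizingPolynomial S f ∧
      ∃ d : R, algebraMap R K d = c ∧ IntegerValued.fixedDivisor f = Ideal.span {d} := by
  open IntegerValued in
  obtain ⟨π, hπ⟩ := IsDiscreteValuationRing.exists_irreducible R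
  have hSne : Nonempty S := hS.to_subtype
  have hmap : ∀ k : S → ℕ, f = ∏ s : S, (X - C (s : R)) ^ k s →
      f.map (algebraMap R K) = linProd K S k := fun k hk => by
    simp [hk, linProd, Polynomial.map_prod]
  have hdeg : ∀ (y : K) (k : S → ℕ), y ≠ 0 → (∀ s, 0 < k s) →
      0 < (C y * linProd K S k).natDegree := fun y k hy hk => by
    rw [natDegree_C_mul_linProd K hy]
    exact Finset.sum_pos (fun s _ => hk s) Finset.univ_nonempty
  have hcast : ∀ (ρ : S → ℕ), (∀ s t : S, (t : R) ∈ nbhd (s : R) (ρ s) → t = s) →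
      ∀ (k : S → ℕ) (s : S), (((partitionMatrix S ρ).mulVec k s : ℕ) : ℤ) =
        (blockMatrix S ρ).mulVec (fun t => (k t : ℤ)) s := fun ρ h k s => by
    simp only [Matrix.mulVec, dotProduct, Nat.cast_sum, Nat.cast_mul,
      partitionMatrix_eq_blockMatrix h]
  constructor
  · rintro ⟨hmem, habs⟩
    -- The order of `c⁻¹` is called `z`, so `-z = v(c)` plays the role of `e`.
    obtain ⟨ρ, hρ, hρ'⟩ := exists_isAssociatedPartition S hS
    obtain ⟨z, hz⟩ := exists_hasOrder hπ (inv_ne_zero hc)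
    rw [← neg_neg z] at hz
    have hFm : F = C c⁻¹ * linProd K S m := by rw [hF, hmap m hf]
    obtain ⟨he, hsingle⟩ := habs.blockMatrix_mulVec_eq hπ hρ hρ' hS hm hz hFm
    have he0 : 0 ≤ -z := by
      obtain ⟨s⟩ := id hSne
      rw [← he s, ← hcast ρ hsingle]
      exact Int.natCast_nonneg _
    refine ⟨isBalanced_of_isAssociatedPartition hρ hsingle,
      ⟨ρ, m, (-z).toNat, hρ, hm, gcd_eq_one_of_irreducible hπ hρ hS hm hz hFm habs.1 he,
        funext fun s => ?_, hf⟩,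
      exists_fixedDivisor_eq_span hc hF (hFm ▸ hdeg _ m (inv_ne_zero hc) hm) habs.1⟩
    rw [← he s, ← hcast ρ hsingle, Int.toNat_natCast]
  · rintro ⟨hbal, ⟨ρ, k, e, hρ, hk, hgcd, hke, hfk⟩, d, rfl, hd⟩
    have hsingle : ∀ s t : S, (t : R) ∈ nbhd (s : R) (ρ s) → t = s := fun s t =>
      hbal.eq_of_mem_nbhd hρ
    have he : ∀ s, (blockMatrix S ρ).mulVec (fun t => (k t : ℤ)) s = e := fun s => by
      rw [← hcast ρ hsingle, hke]
    have hmem : F ∈ intPoly R K := by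
      rw [hF]
      refine C_mul_map_mem_intPoly_iff.2 fun x hx => ?_
      rw [hd, Ideal.mem_span_singleton] at hx
      obtain ⟨q, rfl⟩ := hx
      exact ⟨q, by rw [map_mul, inv_mul_cancel_left₀ hc]⟩
    have hFk : F = C (algebraMap R K d)⁻¹ * linProd K S k := by rw [hF, hmap k hfk]
    obtain ⟨z, hz⟩ := exists_hasOrder hπ (inv_ne_zero hc)
    have hz1 : 0 ≤ z + e := by
      obtain ⟨s⟩ := id hSne
      rw [← he s]
      exact (C_mul_linProd_mem_intPoly_iff hπ hρ hz k).1 (hFk ▸ hmem) s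
    -- The polynomial `π ^ (-e) f` is integer-valued too, and `d` lies in the fixed divisor, so `π ^
    -- (-e) d` lies in `R`. With the previous bound this gives `v(d) = e`.
    have hz2 : 0 ≤ -e + -z := by
      have hp := hasOrder_zpow (K := K) (π := π) (-(e : ℤ))
      have h1 := (C_mul_linProd_mem_intPoly_iff hπ hρ hp k).2 fun s => by
        rw [he s, neg_add_cancel]
      rw [← hmap k hfk] at h1
      have h2 := C_mul_map_mem_intPoly_iff.1 h1 d (hd ▸ Ideal.mem_span_singleton_self d)
      have h3 := hz.inv
      rw [inv_inv] at h3
      exact ((hp.mul hπ h3).mem_range_iff hπ).1 h2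
    obtain rfl : z = -e := by omega
    refine ⟨hmem, isAbsolutelyIrreducible_of_forall_mul_eq_pow
      (hFk ▸ hdeg _ k (inv_ne_zero hc) hk) fun G H n hGH => ?_⟩
    exact exists_eq_of_mul_eq_pow hπ hρ hsingle hS hk hgcd he hz hFk hGH
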